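/- For a real number $x$ write its regular continued fraction as $x=[n_0,n_1,n_2,\dots]$, with partial quotients $n_1,n_2,\dots$. For $x\ge 0$ let $a(x)\in\{0,1\}^{\mathbb N}$ be the string $0^{n_0}1^{n_1}0^{n_2}1^{n_3}\cdots$ of digits of the infinite path in the Farey tree that leads to $x$ (it is unique if $x$ is irrational; for rational $x$ the one of the two paths that ends in ones is taken), and for $s\in\{0,1\}^{\mathbb N}$ let $\mathrm{cfm}(s)\in\mathbb R\cup\{\infty\}$ be the point to which the path $s$ leads. The involution jimm is defined by $\mathrm{jimm}(x)=\mathrm{cfm}(a(x)\oplus 0101\cdots)$ for $x\ge 0$, where $\oplus$ is the termwise exclusive or, and by $\mathrm{jimm}(x)=-1/\mathrm{cfm}(a(-1/x)\oplus 1010\cdots)$ for $x<0$; it is canonically defined at irrational $x$, and at a rational $x$ this picks one of its two possible values. In particular, $\mathrm{jimm}([n_0,n_1,n_2,\dots])=[1_{n_0-1},2,1_{n_1-2},2,1_{n_2-2},\dots]$ for irrational $x$ with all $n_i\ge 2$, where $1_k$ is a string of $k$ ones. A number obeys the Gauss--Kuzmin statistics if for every integer $k>0$ the frequency of $k$ among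 its partial quotients converges to $\frac1{\log 2}\log\bigl(1+\frac1{k(k+2)}\bigr)$. Let $X$ be a random variable uniformly distributed on $[0,1]$. Then almost surely $X$ is irrational and $\mathrm{jimm}(X)$ is an irrational real number $[m_0,m_1,m_2,\dots]$ such that 1. the density of $1$'s among its partial quotients is $1$: $\ \lim_{N\to\infty}\frac1N\,\#\{1\le i\le N: m_i=1\}=1$; 2. the means of its partial quotients tend to $1$: $\ \lim_{N\to\infty}\frac1N(m_1+\dots+m_N)=1$; 3. $\mathrm{jimm}(X)$ does not obey the Gauss--Kuzmin statistics. Moreover, let $A$ be the set of all $x=[0,n_1,n_2,\dots]\in[0,1]$ with $\lim_{k\to\infty}\frac{n_1+\dots+n_k}{k}=\infty$. Then $A$ has full Lebesgue measure in $[0,1]$, $\mathrm{jimm}$ takes only finite values on $A$, and $\mathrm{jimm}(A)$ is a set of Lebesgue measure zero. -/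

import Mathlib

open Filter Topology MeasureTheory

noncomputable section

namespace Jimm

/-! ### Ends of the Farey tree, coded by strings over `{0, 1}` -/

/-- An infinite path in one half of the Farey tree, starting at the base edge: `false` is the
digit `0` (a turn `L`), `true` is the digit `1` (a turn `L ^ 2`). -/
abbrev Path : Type := ℕ → Bool

/-- The Moebius map by which a digit acts on the positive half-line:
`0` acts as `LS : x ↦ 1 + x` and `1` acts as `L ^ 2 S : x ↦ x / (1 + x)`. -/
def move (b : Bool) (x : ℝ) : ℝ :=
  if b then x / (1 + x) else 1 + x

/-- `pathApprox s n = W (1)`, where `W` is the composition of the moves of the first `n` digits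
of `s`. This is the rational number that labels the `n`-th trivalent vertex on the path. -/
def pathApprox : Path → ℕ → ℝ
  | _, 0 => 1
  | s, n + 1 => move (s 0) (pathApprox (fun k => s (k + 1)) n)

/-- The continued fraction map: the point of `ℝ ∪ {∞}` to which a path leads. The path with
`n₀` zeros, `n₁` ones, `n₂` zeros, ... leads to `[n₀, n₁, n₂, ...]`. -/
def cfm (s : Path) : OnePoint ℝ :=
  limUnder atTop (fun n => ((pathApprox s n : ℝ) : OnePoint ℝ))

/-- The first digit of the path that leads to `x ≥ 0`. -/
def firstDigit (x : ℝ) : Bool :=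
  decide (x < 1)

/-- The number to which the rest of the path leads after its first digit is removed. -/
def step (x : ℝ) : ℝ :=
  if x < 1 then x / (1 - x) else x - 1

/-- The path that leads to `x ≥ 0`. It is unique if `x` is irrational; for rational `x` this is
one of the two paths, the one that ends in ones. -/
def pathOf (x : ℝ) : Path :=
  fun n => firstDigit (step^[n] x)

/-- The zig-zag path `0, 1, 0, 1, ...`. -/
def zigzag : Path :=
  fun n => decide (n % 2 = 1)

/-- The termwise exclusive or of two strings. -/
def xorPath (a b : Path) : Path :=
  fun n => xor (a n) (b n)

/-- The termwise negation of a string. -/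
def notPath (a : Path) : Path :=
  fun n => !(a n)

/-- The map `S : z ↦ -1 / z` of `ℝ ∪ {∞}`, which exchanges `0` and `∞`. -/
def negInv (z : OnePoint ℝ) : OnePoint ℝ :=
  z.elim ((0 : ℝ) : OnePoint ℝ)
    (fun x => if x = 0 then OnePoint.infty else ((-1 / x : ℝ) : OnePoint ℝ))

/-- The involution jimm. A number `x ≥ 0` with path `a` is sent to the end of the path
`a xor 0101...`. A negative number is `S (a)`, where `a` is the path of `-1 / x`, and it is sent to
`S (a xor 1010...)`. Jimm is canonically defined at irrational numbers; at a rational number this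
is one of its two values. -/
def jimm (x : ℝ) : OnePoint ℝ :=
  if 0 ≤ x then cfm (xorPath (pathOf x) zigzag)
  else negInv (cfm (xorPath (pathOf (-1 / x)) (notPath zigzag)))

/-! ### Statistics of partial quotients -/

/-- `partialQuotient x i` is the partial quotient `n_{i+1}` of `x = [n₀, n₁, n₂, ...]`
(and `0` if the expansion stops before it, which happens only for rational `x`). -/
def partialQuotient (x : ℝ) (i : ℕ) : ℝ :=
  ((GenContFract.of x).partDens.get? i).getD 0

/-- The arithmetic mean `(n₁ + ... + n_N) / N`. -/
def quotientMean (x : ℝ) (N : ℕ) : ℝ :=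
  (∑ i ∈ Finset.range N, partialQuotient x i) / N

open Classical in
/-- The proportion of the indices `1 ≤ i ≤ N` with `n_i = k`. -/
def quotientFrequency (x : ℝ) (k N : ℕ) : ℝ :=
  (((Finset.range N).filter (fun i => partialQuotient x i = (k : ℝ))).card : ℝ) / N

/-- `x` obeys the Gauss-Kuzmin statistics: the frequency of every integer `k > 0` among the
partial quotients of `x` converges to `(1 / log 2) log (1 + 1 / (k (k + 2)))`. -/
def ObeysGaussKuzmin (x : ℝ) : Prop :=
  ∀ k : ℕ, 0 < k →
    Tendsto (quotientFrequency x k) atTop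
      (𝓝 ((1 / Real.log 2) * Real.log (1 + 1 / ((k : ℝ) * ((k : ℝ) + 2)))))

/-- The numbers of the unit interval whose partial quotients have means tending to infinity. -/
def infiniteMeanSet : Set ℝ :=
  {x | x ∈ Set.Icc (0 : ℝ) 1 ∧ Tendsto (quotientMean x) atTop atTop}

end Jimm

end

namespace Jimm

/-! ### The Gauss map and the divergence of the means of the partial quotients -/

/-! The path of an irrational `x` in (0, 1) changes its digit exactly after n₁ + ... + n_N digits,
for N ≥ 1 (`turnCount_digitSum`). The exclusive or with an alternating string exchanges turns and
non-turns (`turnCount_xorPath_zigzag`). If the means of the n_i tend to infinity, turns have density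
0 on the path of `x`, hence density 1 on that of its image, whose quotients then have mean 1
(`jimm_of_mem_infiniteMeanSet`). Quotients being positive integers, mean 1 forces density 1 of ones,
against Gauss–Kuzmin. It also puts the image of A inside the complement of A.

That A has full measure is proved without the ergodic theorem. The densities (1 + r) / (1 + r x)²
are permuted, up to weights, by the branches of the Gauss map, so the moment of z ^ (n₁ + ... + n_N)
is at most 2 ρ ^ N (`digitMoment_le`). Divergence of the harmonic series allows ρ < z ^ C for any C
(`exists_contraction`); Markov and Borel–Cantelli conclude. -/

/-- The Gauss map `x ↦ {1 / x}`. -/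
noncomputable def gauss (x : ℝ) : ℝ := Int.fract x⁻¹

/-- The sum of the first `N` partial quotients of a number of the unit interval. -/
noncomputable def digitSum : ℕ → ℝ → ℕ
  | 0, _ => 0
  | N + 1, x => ⌊x⁻¹⌋₊ + digitSum N (gauss x)

lemma measurable_gauss : Measurable gauss :=
  measurable_fract.comp measurable_inv

lemma measurable_digitSum (N : ℕ) : Measurable (digitSum N) := by
  induction N with
  | zero => exact measurable_const
  | succ N ih =>
    exact (Nat.measurable_floor.comp measurable_inv).add (ih.comp measurable_gauss)

lemma digitSum_succ_inv (N k : ℕ) {t : ℝ} (ht : t ∈ Set.Ico (0 : ℝ) 1) :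
    digitSum (N + 1) (k + 1 + t)⁻¹ = (k + 1) + digitSum N t := by
  have h1 : ⌊(k + 1 + t : ℝ)⌋₊ = k + 1 := by
    rw [Nat.floor_eq_iff (by have := ht.1; positivity)]
    push_cast
    exact ⟨by linarith [ht.1], by linarith [ht.2]⟩
  have h2 : Int.fract (k + 1 + t : ℝ) = t := by
    rw [Int.fract_eq_iff]
    exact ⟨ht.1, ht.2, (k + 1 : ℤ), by push_cast; ring⟩
  simp only [digitSum, gauss, inv_inv, h1, h2]

/-- The weight of the branch `x = 1 / (k + 1 + t)` of the Gauss map for the density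
`(1 + r) / (1 + r x) ^ 2`. -/
noncomputable def branchWeight (r : ℝ) (k : ℕ) : ℝ := (1 + r) / ((k + 1 + r) * (k + 2 + r))

lemma branchWeight_nonneg {r : ℝ} (hr : 0 ≤ r) (k : ℕ) : 0 ≤ branchWeight r k := by
  unfold branchWeight; positivity

/-- Abel summation: the weight is the difference of (1 + r) / (k + 1 + r) at consecutive k. The
factor 1 - z now multiplies a sum that diverges as K grows and z tends to 1. -/
lemma sum_branchWeight {r : ℝ} (hr : 0 ≤ r) (z : ℝ) (K : ℕ) :
    ∑ k ∈ Finset.range K, z ^ (k + 1) * branchWeight r k =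
      z - (1 - z) * ∑ k ∈ Finset.range K, z ^ (k + 1) * ((1 + r) / (k + 2 + r))
        - z ^ (K + 1) * ((1 + r) / (K + 1 + r)) := by
  induction K with
  | zero =>
    have : (1 + r) ≠ 0 := by positivity
    simp [this]
  | succ K ih =>
    have h1 : (K + 1 + r : ℝ) ≠ 0 := by positivity
    have h2 : (K + 2 + r : ℝ) ≠ 0 := by positivity
    have h3 : branchWeight r K = (1 + r) / (K + 1 + r) - (1 + r) / (K + 2 + r) := by
      unfold branchWeight; field_simp; ring
    have h4 : ((K + 1 : ℕ) + 1 + r : ℝ) = K + 2 + r := by push_cast; ring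
    rw [Finset.sum_range_succ, Finset.sum_range_succ, ih, h3, h4]
    ring

/-- The infinite mean of a partial quotient enters here. For z near 1 the subtracted sum exceeds C,
so ρ < z - (1 - z) C < 1 - C (1 - z) ≤ z ^ C by Bernoulli. Since (1 + r) / (k + 2 + r) ≥ 1 / (k +
2), the choice is uniform in r. -/
lemma exists_contraction (C : ℕ) : ∃ z ρ : ℝ, 0 < z ∧ z < 1 ∧ 0 ≤ ρ ∧ ρ < z ^ C ∧
    ∀ r : ℝ, 0 ≤ r → ∀ K : ℕ,
      ∑ k ∈ Finset.range K, z ^ (k + 1) * branchWeight r k ≤ ρ := by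
  obtain ⟨M, hM⟩ := ((tendsto_atTop.1 Real.tendsto_sum_range_one_div_nat_succ_atTop)
    -- The margin pays for the first harmonic term 1, absent from the shifted sum.
    (C + 2 : ℝ)).exists
  have hM' : (C : ℝ) < ∑ k ∈ Finset.range M, (1 : ℝ) ^ (k + 1) / (k + 2) := by
    have h := Finset.sum_range_succ' (fun i : ℕ => 1 / ((i : ℝ) + 1)) M
    have h0 := Finset.sum_range_succ (fun i : ℕ => 1 / ((i : ℝ) + 1)) M
    have hp : (0 : ℝ) < 1 / ((M : ℝ) + 1) := by positivity
    have he : ∑ k ∈ Finset.range M, (1 : ℝ) ^ (k + 1) / ((k : ℝ) + 2) =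
        ∑ k ∈ Finset.range M, 1 / (((k + 1 : ℕ) : ℝ) + 1) := by
      refine Finset.sum_congr rfl fun k _ => ?_
      push_cast
      rw [one_pow]
      ring
    rw [he]
    simp only [Nat.cast_zero, zero_add, div_one] at h
    linarith
  have hc : Continuous fun z : ℝ => ∑ k ∈ Finset.range M, z ^ (k + 1) / ((k : ℝ) + 2) := by
    fun_prop
  have hev : ∀ᶠ z in 𝓝[<] (1 : ℝ),
      (C : ℝ) < ∑ k ∈ Finset.range M, z ^ (k + 1) / ((k : ℝ) + 2) :=
    (hc.continuousAt.eventually (lt_mem_nhds hM')).filter_mono nhdsWithin_le_nhds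
  have hz : ∀ᶠ z in 𝓝[<] (1 : ℝ), z ∈ Set.Ioo (0 : ℝ) 1 := Ioo_mem_nhdsLT one_pos
  obtain ⟨z, hCz, hz0, hz1⟩ := (hev.and hz).exists
  have hbound : ∀ r : ℝ, 0 ≤ r → ∀ K : ℕ,
      ∑ k ∈ Finset.range K, z ^ (k + 1) * branchWeight r k ≤
        z - (1 - z) * ∑ k ∈ Finset.range M, z ^ (k + 1) / ((k : ℝ) + 2) := by
    intro r hr K
    calc ∑ k ∈ Finset.range K, z ^ (k + 1) * branchWeight r k
        ≤ ∑ k ∈ Finset.range (max K M), z ^ (k + 1) * branchWeight r k := by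
          refine Finset.sum_le_sum_of_subset_of_nonneg
            (Finset.range_subset_range.2 (le_max_left _ _)) fun k _ _ => ?_
          have := branchWeight_nonneg hr k
          positivity
      _ ≤ z - (1 - z) * ∑ k ∈ Finset.range (max K M), z ^ (k + 1) * ((1 + r) / (k + 2 + r)) := by
          rw [sum_branchWeight hr]
          have : 0 ≤ z ^ (max K M + 1) * ((1 + r) / ((max K M : ℕ) + 1 + r)) := by positivity
          linarith
      _ ≤ _ := by
          have h1z : 0 ≤ 1 - z := by linarith
          gcongr
          calc ∑ k ∈ Finset.range M, z ^ (k + 1) / ((k : ℝ) + 2)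
              ≤ ∑ k ∈ Finset.range (max K M), z ^ (k + 1) / ((k : ℝ) + 2) :=
                Finset.sum_le_sum_of_subset_of_nonneg
                  (Finset.range_subset_range.2 (le_max_right _ _)) fun k _ _ => by positivity
            _ ≤ _ := by
              refine Finset.sum_le_sum fun k _ => ?_
              rw [div_eq_mul_one_div]
              refine mul_le_mul_of_nonneg_left ?_ (by positivity)
              rw [div_le_div_iff₀ (by positivity) (by positivity)]
              nlinarith [Nat.cast_nonneg (α := ℝ) k]
  refine ⟨z, _, hz0, hz1, ?_, ?_, hbound⟩
  · simpa using hbound 0 le_rfl 0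
  · have hb := one_add_mul_le_pow (a := z - 1) (by linarith) C
    rw [add_sub_cancel] at hb
    have : (1 - z) * C < (1 - z) * ∑ k ∈ Finset.range M, z ^ (k + 1) / ((k : ℝ) + 2) :=
      mul_lt_mul_of_pos_left hCz (by linarith)
    nlinarith

lemma Ioc_subset_iUnion_inv :
    Set.Ioc (0 : ℝ) 1 ⊆ ⋃ k : ℕ, (fun t : ℝ => (k + 1 + t)⁻¹) '' Set.Ico 0 1 := by
  intro x hx
  have h1 : 1 ≤ x⁻¹ := (one_le_inv₀ hx.1).2 hx.2
  have h2 : 1 ≤ ⌊x⁻¹⌋₊ := Nat.le_floor (by exact_mod_cast h1)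
  have h3 := Nat.floor_le (zero_le_one.trans h1)
  have h4 := Nat.lt_floor_add_one x⁻¹
  refine Set.mem_iUnion.2 ⟨⌊x⁻¹⌋₊ - 1, x⁻¹ - ⌊x⁻¹⌋₊, ⟨by linarith, by linarith⟩, ?_⟩
  rw [Nat.cast_sub h2]
  simp

/-- The exponential moment of the digit sum with respect to the density
`(1 + r) / (1 + r x) ^ 2`. -/
noncomputable def digitMoment (z : ℝ) (N : ℕ) (r : ℝ) : ENNReal :=
  ∫⁻ x in Set.Ico (0 : ℝ) 1, ENNReal.ofReal (z ^ digitSum N x * ((1 + r) / (1 + r * x) ^ 2))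

/-- Change of variables x = 1 / (k + 1 + t) turns the density of parameter r into `branchWeight r k`
times the density of parameter 1 / (k + 1 + r). Subadditivity over the branches suffices, so their
disjointness is not needed. -/
lemma digitMoment_succ_le {z : ℝ} (hz : 0 ≤ z) (N : ℕ) {r : ℝ} (hr : 0 ≤ r) :
    digitMoment z (N + 1) r ≤ ∑' k : ℕ, ENNReal.ofReal (z ^ (k + 1) * branchWeight r k) *
      digitMoment z N (k + 1 + r)⁻¹ := by
  rw [digitMoment, Measure.restrict_congr_set Ico_ae_eq_Ioc]
  refine (lintegral_mono_set Ioc_subset_iUnion_inv).trans ((lintegral_iUnion_le _ _).trans ?_)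
  refine ENNReal.tsum_le_tsum fun k => ?_
  have hd : ∀ t ∈ Set.Ico (0 : ℝ) 1, HasDerivWithinAt (fun t : ℝ => (k + 1 + t)⁻¹)
      (-1 / (k + 1 + t) ^ 2) (Set.Ico 0 1) t := fun t ht => by
    have ht0 : (k + 1 + t : ℝ) ≠ 0 := by have := ht.1; positivity
    exact (((hasDerivAt_id t).const_add (k + 1 : ℝ)).fun_inv ht0).hasDerivWithinAt
  have hinj : Set.InjOn (fun t : ℝ => (k + 1 + t)⁻¹) (Set.Ico 0 1) := fun a _ b _ h => by
    simpa using h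
  rw [lintegral_image_eq_lintegral_abs_deriv_mul measurableSet_Ico hd hinj, digitMoment,
    ← lintegral_const_mul' _ _ ENNReal.ofReal_ne_top]
  refine le_of_eq (setLIntegral_congr_fun measurableSet_Ico fun t ht => ?_)
  have ht0 := ht.1
  have hw := branchWeight_nonneg hr k
  rw [digitSum_succ_inv N k ht, ← ENNReal.ofReal_mul (abs_nonneg _),
    ← ENNReal.ofReal_mul (by positivity)]
  congr 1
  rw [abs_div, abs_neg, abs_one, abs_of_nonneg (by positivity), pow_add, branchWeight]
  have h1 : (k + 1 + t : ℝ) ≠ 0 := by positivity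
  have h2 : (k + 1 + r : ℝ) ≠ 0 := by positivity
  have h3 : (k + 2 + r : ℝ) ≠ 0 := by positivity
  have h4 : (k + 1 + t + r : ℝ) ≠ 0 := by positivity
  have e1 : 1 + r * (k + 1 + t : ℝ)⁻¹ = (k + 1 + t + r) / (k + 1 + t) := by field_simp
  have e2 : 1 + (k + 1 + r : ℝ)⁻¹ * t = (k + 1 + t + r) / (k + 1 + r) := by field_simp; ring
  have e3 : 1 + (k + 1 + r : ℝ)⁻¹ = (k + 2 + r) / (k + 1 + r) := by field_simp; ring
  rw [e1, e2, e3]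
  field_simp

lemma digitMoment_le {z ρ : ℝ} (hz : 0 ≤ z) (hρ : 0 ≤ ρ)
    (h : ∀ r : ℝ, 0 ≤ r → ∀ K : ℕ,
      ∑ k ∈ Finset.range K, z ^ (k + 1) * branchWeight r k ≤ ρ) (N : ℕ) :
    ∀ r : ℝ, 0 ≤ r → r ≤ 1 → digitMoment z N r ≤ ENNReal.ofReal (2 * ρ ^ N) := by
  induction N with
  | zero =>
    intro r hr hr1
    have : digitMoment z 0 r ≤ ∫⁻ _ in Set.Ico (0 : ℝ) 1, ENNReal.ofReal 2 := by
      refine setLIntegral_mono' measurableSet_Ico fun x hx => ENNReal.ofReal_le_ofReal ?_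
      have hx0 := hx.1
      have : 1 ≤ (1 + r * x) ^ 2 := one_le_pow₀ (by nlinarith)
      simp only [digitSum, pow_zero, one_mul]
      rw [div_le_iff₀ (by positivity)]
      nlinarith
    simpa using this
  | succ N ih =>
    intro r hr _
    refine (digitMoment_succ_le hz N hr).trans ?_
    have hle : ∀ k : ℕ, digitMoment z N (k + 1 + r)⁻¹ ≤ ENNReal.ofReal (2 * ρ ^ N) := fun k =>
      ih _ (by positivity) (inv_le_one_of_one_le₀ (by
        have := Nat.cast_nonneg (α := ℝ) k
        linarith))
    calc _ ≤ ∑' k : ℕ, ENNReal.ofReal (z ^ (k + 1) * branchWeight r k) *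
          ENNReal.ofReal (2 * ρ ^ N) := ENNReal.tsum_le_tsum fun k => by gcongr; exact hle k
      _ ≤ ENNReal.ofReal ρ * ENNReal.ofReal (2 * ρ ^ N) := by
          rw [ENNReal.tsum_mul_right]
          gcongr
          refine ENNReal.tsum_le_of_sum_range_le fun K => ?_
          rw [← ENNReal.ofReal_sum_of_nonneg fun k _ => by
            have := branchWeight_nonneg hr k
            positivity]
          exact ENNReal.ofReal_le_ofReal (h r hr K)
      _ = _ := by
          rw [← ENNReal.ofReal_mul hρ]
          congr 1
          ring

lemma ae_eventually_lt_digitSum (C : ℕ) :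
    ∀ᵐ x ∂volume.restrict (Set.Ico (0 : ℝ) 1), ∀ᶠ N in atTop, C * N < digitSum N x := by
  obtain ⟨z, ρ, hz0, hz1, hρ, hρz, h⟩ := exists_contraction C
  have hzC : 0 < z ^ C := by positivity
  have hq0 : 0 ≤ ρ / z ^ C := by positivity
  have hq : ρ / z ^ C < 1 := (div_lt_one hzC).2 hρz
  have hmeas : ∀ N, (volume.restrict (Set.Ico (0 : ℝ) 1)) {x | digitSum N x ≤ C * N} ≤
      ENNReal.ofReal (2 * (ρ / z ^ C) ^ N) := by
    intro N
    have hm : Measurable fun x => ENNReal.ofReal (z ^ digitSum N x) :=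
      ENNReal.measurable_ofReal.comp ((measurable_from_top (f := fun n : ℕ => z ^ n)).comp
        (measurable_digitSum N))
    have hpos : ENNReal.ofReal (z ^ (C * N)) ≠ 0 := by
      simpa using pow_pos hz0 _
    have h1 := meas_ge_le_lintegral_div (μ := volume.restrict (Set.Ico (0 : ℝ) 1))
      hm.aemeasurable hpos ENNReal.ofReal_ne_top
    have h2 : ∫⁻ x in Set.Ico (0 : ℝ) 1, ENNReal.ofReal (z ^ digitSum N x) ≤
        ENNReal.ofReal (2 * ρ ^ N) := by
      -- At r = 0 the density is that of Lebesgue measure.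
      simpa [digitMoment] using digitMoment_le hz0.le hρ h N 0 le_rfl zero_le_one
    refine (measure_mono fun x (hx : digitSum N x ≤ C * N) => ?_).trans
      (h1.trans ((ENNReal.div_le_div_right h2 _).trans ?_))
    · exact ENNReal.ofReal_le_ofReal (pow_le_pow_of_le_one hz0.le hz1.le hx)
    · rw [← ENNReal.ofReal_div_of_pos (by positivity), div_pow, ← pow_mul, mul_div_assoc]
  have hsum : ∑' N, (volume.restrict (Set.Ico (0 : ℝ) 1)) {x | digitSum N x ≤ C * N} ≠ ⊤ := by
    refine ne_top_of_le_ne_top ?_ (ENNReal.tsum_le_tsum hmeas)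
    rw [← ENNReal.ofReal_tsum_of_nonneg (fun N => by positivity)
      ((summable_geometric_of_lt_one hq0 hq).mul_left 2)]
    exact ENNReal.ofReal_ne_top
  filter_upwards [ae_eventually_notMem hsum] with x hx
  filter_upwards [hx] with N hN
  simpa using hN

/-! ### Partial quotients -/

lemma partialQuotient_zero (v : ℝ) : partialQuotient v 0 = ⌊(Int.fract v)⁻¹⌋ := by
  unfold partialQuotient
  rcases eq_or_ne (Int.fract v) 0 with h | h
  -- For an integer both sides are 0: the default of `getD`, and `0⁻¹ = 0`.
  · obtain ⟨a, rfl⟩ : ∃ a : ℤ, v = a := ⟨⌊v⌋, eq_of_sub_eq_zero h⟩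
    have h0 : (GenContFract.of (a : ℝ)).s.get? 0 = none := by
      rw [GenContFract.of_s_of_int, Stream'.Seq.get?_nil]
    rw [GenContFract.partDen_none_iff_s_none.2 h0]
    simp
  · have h0 : (GenContFract.of v).s.get? 0 = some ⟨1, ⌊(Int.fract v)⁻¹⌋⟩ :=
      GenContFract.of_s_head h
    rw [GenContFract.partDen_eq_s_b h0]
    rfl

lemma partialQuotient_succ (v : ℝ) (n : ℕ) :
    partialQuotient v (n + 1) = partialQuotient (Int.fract v)⁻¹ n := by
  have h := GenContFract.of_s_succ v n
  unfold partialQuotient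
  cases hs : (GenContFract.of (Int.fract v)⁻¹).s.get? n with
  | none =>
    rw [GenContFract.partDen_none_iff_s_none.2 (h.trans hs),
      GenContFract.partDen_none_iff_s_none.2 hs]
  | some gp => rw [GenContFract.partDen_eq_s_b (h.trans hs), GenContFract.partDen_eq_s_b hs]

lemma partialQuotient_fract (v : ℝ) (n : ℕ) :
    partialQuotient (Int.fract v) n = partialQuotient v n := by
  cases n with
  | zero => rw [partialQuotient_zero, partialQuotient_zero, Int.fract_fract]
  | succ n => rw [partialQuotient_succ, partialQuotient_succ, Int.fract_fract]

lemma gauss_mem_Ico (x : ℝ) : gauss x ∈ Set.Ico (0 : ℝ) 1 :=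
  ⟨Int.fract_nonneg _, Int.fract_lt_one _⟩

lemma sum_partialQuotient (N : ℕ) {x : ℝ} (hx : x ∈ Set.Ico (0 : ℝ) 1) :
    ∑ i ∈ Finset.range N, partialQuotient x i = digitSum N x := by
  induction N generalizing x with
  | zero => simp [digitSum]
  | succ N ih =>
    have hf : Int.fract x = x := Int.fract_eq_self.2 hx
    have hs : ∀ i, partialQuotient x (i + 1) = partialQuotient (gauss x) i := fun i => by
      rw [partialQuotient_succ, hf, gauss, partialQuotient_fract]
    rw [Finset.sum_range_succ', Finset.sum_congr rfl fun i _ => hs i, ih (gauss_mem_Ico x),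
      partialQuotient_zero, hf, digitSum, Nat.cast_add,
      ← natCast_floor_eq_intCast_floor (inv_nonneg.2 hx.1), add_comm]

lemma irrational_fract {x : ℝ} (hx : Irrational x) : Irrational (Int.fract x) :=
  hx.sub_intCast _

lemma exists_partialQuotient_eq_natCast {x : ℝ} (hx : Irrational x) (i : ℕ) :
    ∃ n : ℕ, 1 ≤ n ∧ partialQuotient x i = n := by
  induction i generalizing x with
  | zero =>
    have h0 := (Int.fract_nonneg x).lt_of_ne (irrational_fract hx).ne_zero.symm
    have h1 : 1 ≤ (Int.fract x)⁻¹ := (one_le_inv₀ h0).2 (Int.fract_lt_one x).le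
    refine ⟨⌊(Int.fract x)⁻¹⌋₊, Nat.le_floor (by exact_mod_cast h1), ?_⟩
    rw [partialQuotient_zero, natCast_floor_eq_intCast_floor (by positivity)]
  | succ i ih =>
    rw [partialQuotient_succ]
    exact ih (irrational_fract hx).inv

/-! ### Statistics of partial quotients -/

lemma quotientMean_eq {x : ℝ} (hx : x ∈ Set.Ico (0 : ℝ) 1) (N : ℕ) :
    quotientMean x N = digitSum N x / N := by
  rw [quotientMean, sum_partialQuotient N hx]

lemma tendsto_quotientMean_atTop_iff {x : ℝ} (hx : x ∈ Set.Ico (0 : ℝ) 1) :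
    Tendsto (quotientMean x) atTop atTop ↔
      ∀ C : ℕ, ∀ᶠ N in atTop, C * N < digitSum N x := by
  simp only [funext fun N => quotientMean_eq hx N]
  constructor
  · intro h C
    filter_upwards [h.eventually_gt_atTop (C : ℝ), eventually_gt_atTop 0] with N hN h0
    rw [lt_div_iff₀ (by exact_mod_cast h0)] at hN
    exact_mod_cast hN
  · intro h
    refine tendsto_atTop.2 fun b => ?_
    obtain ⟨C, hC⟩ := exists_nat_ge b
    filter_upwards [h C, eventually_gt_atTop 0] with N hN h0
    refine hC.trans ?_
    rw [le_div_iff₀ (by exact_mod_cast h0)]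
    exact_mod_cast hN.le

lemma volume_Icc_diff_infiniteMeanSet : volume (Set.Icc (0 : ℝ) 1 \ infiniteMeanSet) = 0 := by
  have h := ae_all_iff.2 ae_eventually_lt_digitSum
  rw [Measure.restrict_congr_set Ico_ae_eq_Icc,
    ae_restrict_iff' measurableSet_Icc] at h
  have h1 : ∀ᵐ x : ℝ ∂volume, x ≠ 1 := by simp [ae_iff]
  refine measure_mono_null (fun x hx => ?_) (ae_iff.1 (h.and h1))
  intro hx'
  have hx1 : x ∈ Set.Ico (0 : ℝ) 1 := ⟨hx.1.1, hx.1.2.lt_of_ne hx'.2⟩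
  exact hx.2 ⟨hx.1, (tendsto_quotientMean_atTop_iff hx1).2 (hx'.1 hx.1)⟩

/-- The expansion is finite and the default quotient after it is 0, so the means tend to 0. -/
lemma not_tendsto_quotientMean_ratCast (q : ℚ) :
    ¬ Tendsto (quotientMean (q : ℝ)) atTop atTop := by
  obtain ⟨n, hn⟩ := (GenContFract.terminates_iff_rat (q : ℝ)).2 ⟨q, rfl⟩
  have h0 : ∀ m, n ≤ m → partialQuotient (q : ℝ) m = 0 := fun m hm => by
    have := GenContFract.terminated_stable hm hn
    rw [partialQuotient, GenContFract.terminatedAt_iff_partDen_none.1 this]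
    rfl
  have h1 : Tendsto (quotientMean (q : ℝ)) atTop (𝓝 0) := by
    refine (tendsto_const_div_atTop_nhds_zero_nat
      (∑ i ∈ Finset.range n, partialQuotient (q : ℝ) i)).congr' ?_
    filter_upwards [eventually_ge_atTop n] with N hN
    rw [quotientMean, Finset.sum_subset (Finset.range_subset_range.2 hN)]
    intro i _ hi
    exact h0 i (by simpa using hi)
  exact not_tendsto_atTop_of_tendsto_nhds h1

lemma irrational_of_mem_infiniteMeanSet {x : ℝ} (hx : x ∈ infiniteMeanSet) : Irrational x := by
  rintro ⟨q, rfl⟩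
  exact not_tendsto_quotientMean_ratCast q hx.2

/-- A positive integer n satisfies n + [n = 1] ≥ 2; averaging bounds the frequency of ones below by
2 minus the mean. -/
lemma tendsto_quotientFrequency_one {y : ℝ} (hy : Irrational y)
    (h : Tendsto (quotientMean y) atTop (𝓝 1)) :
    Tendsto (quotientFrequency y 1) atTop (𝓝 1) := by
  have h2 : Tendsto (fun N => 2 - quotientMean y N) atTop (𝓝 1) := by
    simpa [show (2 : ℝ) - 1 = 1 by norm_num] using h.const_sub 2
  refine tendsto_of_tendsto_of_tendsto_of_le_of_le' h2 tendsto_const_nhds ?_ ?_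
  · filter_upwards [eventually_gt_atTop 0] with N hN
    have hN' : (0 : ℝ) < N := by exact_mod_cast hN
    rw [quotientMean, quotientFrequency, sub_le_iff_le_add, ← add_div, le_div_iff₀ hN',
      Finset.card_filter, Nat.cast_sum, ← Finset.sum_add_distrib]
    have : ∑ i ∈ Finset.range N, (2 : ℝ) = 2 * N := by simp [mul_comm]
    rw [← this]
    refine Finset.sum_le_sum fun i _ => ?_
    obtain ⟨n, hn, hi⟩ := exists_partialQuotient_eq_natCast hy i
    rw [hi]
    split_ifs with h1
    · rw [h1]; norm_num
    · have : 2 ≤ n := by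
        have : n ≠ 1 := fun h => h1 (by rw [h])
        omega
      have : (2 : ℝ) ≤ n := by exact_mod_cast this
      simpa using this
  · filter_upwards [] with N
    refine div_le_one_of_le₀ ?_ (Nat.cast_nonneg N)
    exact_mod_cast (Finset.card_filter_le _ _).trans (Finset.card_range N).le

lemma not_obeysGaussKuzmin {y : ℝ} (h : Tendsto (quotientFrequency y 1) atTop (𝓝 1)) :
    ¬ ObeysGaussKuzmin y := by
  intro hy
  have h1 := tendsto_nhds_unique h (hy 1 one_pos)
  have hl : 0 < Real.log 2 := Real.log_pos one_lt_two
  have h2 : Real.log (1 + 1 / (((1 : ℕ) : ℝ) * (((1 : ℕ) : ℝ) + 2))) < Real.log 2 :=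
    Real.log_lt_log (by norm_num) (by norm_num)
  rw [one_div_mul_eq_div, eq_comm, div_eq_one_iff_eq hl.ne'] at h1
  exact h2.ne h1

/-! ### Convergence of paths -/

/-- The composition of the moves of the first `n` digits of a path. -/
noncomputable def moves : Path → ℕ → ℝ → ℝ
  | _, 0, x => x
  | s, n + 1, x => move (s 0) (moves (fun k => s (k + 1)) n x)

/-- A path on which both digits occur infinitely often. -/
def Mixed (s : Path) : Prop := ∀ (b : Bool) (N : ℕ), ∃ n ≥ N, s n = b

lemma Mixed.shift {s : Path} (hs : Mixed s) (j : ℕ) : Mixed (fun k => s (j + k)) := by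
  intro b N
  obtain ⟨n, hn, h⟩ := hs b (j + N)
  exact ⟨n - j, by omega, by simpa only [Nat.add_sub_cancel' (show j ≤ n by omega)] using h⟩

lemma Mixed.tail {s : Path} (hs : Mixed s) : Mixed (fun k => s (k + 1)) := by
  simpa only [add_comm] using hs.shift 1

lemma Mixed.exists_true_false {s : Path} (hs : Mixed s) :
    ∃ j, s j = true ∧ s (j + 1) = false := by
  by_contra! h
  obtain ⟨n, -, hn⟩ := hs true 0
  obtain ⟨m, hm, hm'⟩ := hs false n
  have : s m = true := by
    induction m, hm using Nat.le_induction with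
    | base => exact hn
    | succ m _ ih =>
      by_contra hf
      cases h2 : s m with
      | true => exact h m h2 (by simpa using hf)
      | false => exact absurd (ih h2) (by simp [h2])
  simp [this] at hm'

lemma move_nonneg (b : Bool) {x : ℝ} (hx : 0 ≤ x) : 0 ≤ move b x := by
  unfold move; split_ifs <;> positivity

lemma move_pos (b : Bool) {x : ℝ} (hx : 0 < x) : 0 < move b x := by
  unfold move; split_ifs <;> positivity

lemma abs_move_sub_le (b : Bool) {u v : ℝ} (hu : 0 ≤ u) (hv : 0 ≤ v) :
    |move b u - move b v| ≤ |u - v| := by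
  unfold move
  split_ifs
  · have : u / (1 + u) - v / (1 + v) = (u - v) / ((1 + u) * (1 + v)) := by
      field_simp; ring
    rw [this, abs_div]
    refine div_le_self (abs_nonneg _) ?_
    rw [abs_of_pos (by positivity)]
    nlinarith
  · simp

lemma moves_nonneg (s : Path) (n : ℕ) {x : ℝ} (hx : 0 ≤ x) : 0 ≤ moves s n x := by
  induction n generalizing s with
  | zero => exact hx
  | succ n ih => exact move_nonneg _ (ih _)

lemma abs_moves_sub_le (s : Path) (n : ℕ) {u v : ℝ} (hu : 0 ≤ u) (hv : 0 ≤ v) :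
    |moves s n u - moves s n v| ≤ |u - v| := by
  induction n generalizing s with
  | zero => exact le_rfl
  | succ n ih => exact (abs_move_sub_le _ (moves_nonneg _ n hu) (moves_nonneg _ n hv)).trans (ih _)

lemma moves_add (s : Path) (m n : ℕ) (x : ℝ) :
    moves s (m + n) x = moves s m (moves (fun k => s (m + k)) n x) := by
  induction m generalizing s with
  | zero => simp [moves]
  | succ m ih =>
    rw [Nat.add_right_comm m 1 n, moves, moves, ih]
    simp only [Nat.add_right_comm m 1]

lemma pathApprox_eq_moves (s : Path) (n : ℕ) : pathApprox s n = moves s n 1 := by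
  induction n generalizing s with
  | zero => rfl
  | succ n ih => rw [pathApprox, moves, ih]

/-- A block 10 acts by y ↦ (1 + y) / (2 + y), which contracts [0, ∞) by 1/4. It recurs on a mixed
path, and the other moves do not expand distances. -/
lemma Mixed.exists_abs_moves_sub_le (K : ℕ) {s : Path} (hs : Mixed s) :
    ∃ N, ∀ u v : ℝ, 0 ≤ u → 0 ≤ v → |moves s N u - moves s N v| ≤ (1 / 4) ^ K := by
  induction K generalizing s with
  | zero =>
    obtain ⟨j, -, hj⟩ := hs true 0
    refine ⟨j + 1, fun u v hu hv => ?_⟩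
    have hm : ∀ w : ℝ, moves (fun k => s (j + k)) 1 w = w / (1 + w) := fun w => by
      simp [moves, move, hj]
    have hb : ∀ w : ℝ, 0 ≤ w → 0 ≤ w / (1 + w) ∧ w / (1 + w) ≤ 1 := fun w hw =>
      ⟨by positivity, div_le_one_of_le₀ (by linarith) (by positivity)⟩
    rw [moves_add, moves_add, hm, hm, pow_zero]
    refine (abs_moves_sub_le s j (hb u hu).1 (hb v hv).1).trans (abs_le.2 ⟨?_, ?_⟩) <;>
      linarith [hb u hu, hb v hv]
  | succ K ih =>
    obtain ⟨j, hj, hj'⟩ := hs.exists_true_false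
    obtain ⟨N, hN⟩ := ih (hs.shift (j + 2))
    refine ⟨j + (N + 2), fun u v hu hv => ?_⟩
    have hm : ∀ w : ℝ, moves (fun k => s (j + k)) (N + 2) w =
        (1 + moves (fun k => s (j + 2 + k)) N w) /
          (2 + moves (fun k => s (j + 2 + k)) N w) := fun w => by
      have he : (fun k => s (j + (k + 1 + 1))) = fun k => s (j + 2 + k) := by
        funext k; congr 1; omega
      simp only [moves, move, add_zero, zero_add, hj, hj', he]
      simp only [if_true, Bool.false_eq_true, if_false]
      congr 1
      ring
    have hu' := moves_nonneg (fun k => s (j + 2 + k)) N hu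
    have hv' := moves_nonneg (fun k => s (j + 2 + k)) N hv
    have hN' := hN u v hu hv
    rw [moves_add s j, moves_add s j, hm, hm]
    set a := moves (fun k => s (j + 2 + k)) N u
    set b := moves (fun k => s (j + 2 + k)) N v
    refine (abs_moves_sub_le s j (by positivity) (by positivity)).trans ?_
    have : (1 + a) / (2 + a) - (1 + b) / (2 + b) = (a - b) / ((2 + a) * (2 + b)) := by
      field_simp; ring
    rw [this, abs_div, abs_of_pos (show 0 < (2 + a) * (2 + b) by positivity),
      div_le_iff₀ (by positivity), pow_succ]
    have : 0 ≤ (1 / 4 : ℝ) ^ K := by positivity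
    nlinarith [mul_nonneg hu' hv', mul_nonneg this hu', mul_nonneg this hv',
      mul_nonneg this (mul_nonneg hu' hv')]

lemma Mixed.exists_tendsto {s : Path} (hs : Mixed s) :
    ∃ y : ℝ, Tendsto (pathApprox s) atTop (𝓝 y) := by
  refine cauchySeq_tendsto_of_complete (Metric.cauchySeq_iff'.2 fun ε hε => ?_)
  obtain ⟨K, hK⟩ := exists_pow_lt_of_lt_one hε (show (1 / 4 : ℝ) < 1 by norm_num)
  obtain ⟨N, hN⟩ := hs.exists_abs_moves_sub_le K
  refine ⟨N, fun n hn => lt_of_le_of_lt ?_ hK⟩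
  obtain ⟨m, rfl⟩ := Nat.exists_eq_add_of_le hn
  rw [Real.dist_eq, pathApprox_eq_moves, pathApprox_eq_moves, moves_add]
  exact hN _ _ (moves_nonneg _ _ zero_le_one) zero_le_one

/-- The real number to which a mixed path leads. -/
noncomputable def endpoint (s : Path) : ℝ := limUnder atTop (pathApprox s)

lemma Mixed.tendsto_endpoint {s : Path} (hs : Mixed s) :
    Tendsto (pathApprox s) atTop (𝓝 (endpoint s)) :=
  tendsto_nhds_limUnder hs.exists_tendsto

lemma Mixed.cfm_eq {s : Path} (hs : Mixed s) : cfm s = (endpoint s : OnePoint ℝ) :=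
  ((OnePoint.continuous_coe.tendsto _).comp hs.tendsto_endpoint).limUnder_eq

lemma Mixed.endpoint_nonneg {s : Path} (hs : Mixed s) : 0 ≤ endpoint s :=
  ge_of_tendsto' hs.tendsto_endpoint fun n => by
    rw [pathApprox_eq_moves]; exact moves_nonneg _ _ zero_le_one

lemma continuousAt_move (b : Bool) {x : ℝ} (hx : 0 ≤ x) : ContinuousAt (move b) x := by
  cases b with
  | false => exact (show Continuous fun x : ℝ => 1 + x by fun_prop).continuousAt
  | true =>
    have h : (1 + x) ≠ 0 := by positivity
    exact show ContinuousAt (fun x : ℝ => x / (1 + x)) x by fun_prop (disch := exact h)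

lemma Mixed.endpoint_eq_move {s : Path} (hs : Mixed s) :
    endpoint s = move (s 0) (endpoint fun k => s (k + 1)) :=
  tendsto_nhds_unique ((tendsto_add_atTop_iff_nat 1).2 hs.tendsto_endpoint)
    ((continuousAt_move (s 0) hs.tail.endpoint_nonneg).tendsto.comp hs.tail.tendsto_endpoint)

lemma Mixed.endpoint_pos {s : Path} (hs : Mixed s) : 0 < endpoint s := by
  obtain ⟨n, -, hn⟩ := hs false 0
  induction n generalizing s with
  | zero =>
    have := hs.tail.endpoint_nonneg
    rw [hs.endpoint_eq_move, hn, move]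
    simp only [Bool.false_eq_true, if_false]
    positivity
  | succ n ih =>
    rw [hs.endpoint_eq_move]
    exact move_pos _ (ih hs.tail hn)

lemma firstDigit_move (b : Bool) {x : ℝ} (hx : 0 ≤ x) : firstDigit (move b x) = b := by
  cases b with
  | false => simp [firstDigit, move, hx]
  | true =>
    have : x / (1 + x) < 1 := by rw [div_lt_one (by positivity)]; linarith
    simpa [firstDigit, move] using this

lemma step_move (b : Bool) {x : ℝ} (hx : 0 ≤ x) : step (move b x) = x := by
  cases b with
  | false => simp [step, move, hx]
  | true =>
    have h : x / (1 + x) < 1 := by rw [div_lt_one (by positivity)]; linarith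
    simp only [step, move, if_true, h]
    have h1 : 1 - x / (1 + x) = 1 / (1 + x) := by field_simp; ring
    rw [h1]
    field_simp

lemma pathOf_succ (x : ℝ) (n : ℕ) : pathOf x (n + 1) = pathOf (step x) n := rfl

lemma Mixed.pathOf_endpoint {s : Path} (hs : Mixed s) : pathOf (endpoint s) = s := by
  funext n
  induction n generalizing s with
  | zero =>
    rw [hs.endpoint_eq_move]
    exact firstDigit_move _ hs.tail.endpoint_nonneg
  | succ n ih =>
    rw [hs.endpoint_eq_move, pathOf_succ, step_move _ hs.tail.endpoint_nonneg, ih hs.tail]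

lemma pathOf_zero (n : ℕ) : pathOf 0 n = true := by
  induction n with
  | zero => simp [pathOf, firstDigit]
  | succ n ih => simpa [pathOf_succ, step] using ih

/-- `step` is the subtractive Euclidean algorithm: p + q drops until p = 0, whose path is all ones.
A mixed path therefore cannot lead to a rational. -/
lemma exists_pathOf_div_eq_true (p q : ℕ) (hq : 0 < q) :
    ∃ N, ∀ n ≥ N, pathOf ((p : ℝ) / q) n = true := by
  induction h : p + q using Nat.strong_induction_on generalizing p q with
  | _ m ih =>
    have hq' : (0 : ℝ) < q := by exact_mod_cast hq
    rcases Nat.eq_zero_or_pos p with rfl | hp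
    · exact ⟨0, fun n _ => by simpa using pathOf_zero n⟩
    have key : ∃ N, ∀ n ≥ N, pathOf (step ((p : ℝ) / q)) n = true := by
      rcases lt_or_ge p q with hpq | hpq
      · have hpq' : (p : ℝ) < q := by exact_mod_cast hpq
        have hs : step ((p : ℝ) / q) = (p : ℝ) / (q - p : ℕ) := by
          rw [step, if_pos ((div_lt_one hq').2 hpq'), Nat.cast_sub hpq.le]
          have : (q : ℝ) - p ≠ 0 := by linarith
          field_simp
        rw [hs]
        exact ih _ (by omega) p (q - p) (by omega) rfl
      · have hpq' : (q : ℝ) ≤ p := by exact_mod_cast hpq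
        have hs : step ((p : ℝ) / q) = ((p - q : ℕ) : ℝ) / q := by
          rw [step, if_neg (by rw [div_lt_one hq']; linarith), Nat.cast_sub hpq]
          field_simp
        rw [hs]
        exact ih _ (by omega) (p - q) q hq rfl
    obtain ⟨N, hN⟩ := key
    refine ⟨N + 1, fun n hn => ?_⟩
    obtain ⟨k, rfl⟩ := Nat.exists_eq_add_of_le' (Nat.one_le_of_lt hn)
    exact hN k (by omega)

lemma Mixed.irrational_endpoint {s : Path} (hs : Mixed s) : Irrational (endpoint s) := by
  rintro ⟨q, hq⟩
  have h0 : 0 < q := by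
    have := hs.endpoint_pos
    rw [← hq] at this
    exact_mod_cast this
  obtain ⟨N, hN⟩ := exists_pathOf_div_eq_true q.num.toNat q.den q.den_pos
  have he : ((q.num.toNat : ℕ) : ℝ) / q.den = endpoint s := by
    rw [← hq, Rat.cast_def]
    congr 1
    exact_mod_cast Int.toNat_of_nonneg (Rat.num_nonneg.2 h0.le)
  rw [he, hs.pathOf_endpoint] at hN
  obtain ⟨n, hn, hn'⟩ := hs false N
  simp [hN n hn] at hn'

/-! ### Turns of a path and partial quotients -/

/-- The number of indices `t < T` at which a path changes its digit. -/
def turnCount (s : Path) (T : ℕ) : ℕ := Nat.count (fun t => s t ≠ s (t + 1)) T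

lemma step_pos {x : ℝ} (hx : 0 < x) (h : Irrational x) : 0 < step x := by
  unfold step
  split_ifs with h1
  · exact div_pos hx (by linarith)
  · have := (not_lt.1 h1).lt_of_ne h.ne_one.symm
    linarith

lemma step_inv {x : ℝ} (hx : 0 < x) (h1 : x ≠ 1) : step x⁻¹ = (step x)⁻¹ := by
  unfold step
  rcases lt_or_gt_of_ne h1 with h | h
  · have : ¬ x⁻¹ < 1 := not_lt.2 (one_lt_inv_iff₀.2 ⟨hx, h⟩).le
    rw [if_neg this, if_pos h]
    field_simp
  · rw [if_pos (inv_lt_one_of_one_lt₀ h), if_neg (not_lt.2 h.le)]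
    have : x - 1 ≠ 0 := by linarith
    have h2 : 1 - x⁻¹ = (x - 1) / x := by field_simp
    rw [h2]
    field_simp

lemma irrational_step {x : ℝ} (h : Irrational x) : Irrational (step x) := by
  have key : ∀ y : ℝ, Irrational y → Irrational (y - 1) := fun y hy => by
    simpa using hy.sub_natCast 1
  unfold step
  split_ifs
  · have h0 := h.ne_zero
    have : x / (1 - x) = (x⁻¹ - 1)⁻¹ := by
      rw [← inv_div, sub_div, div_self h0, one_div]
    rw [this]
    exact (key _ h.inv).inv
  · exact key x h

lemma pathOf_inv {x : ℝ} (hx : 0 < x) (h : Irrational x) (n : ℕ) :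
    pathOf x⁻¹ n = !pathOf x n := by
  induction n generalizing x with
  | zero =>
    change decide (x⁻¹ < 1) = !decide (x < 1)
    rw [← decide_not, decide_eq_decide, inv_lt_one_iff₀, not_lt]
    constructor
    · rintro (h' | h')
      · linarith
      · exact h'.le
    · exact fun h' => Or.inr (h'.lt_of_ne h.ne_one.symm)
  | succ n ih => rw [pathOf_succ, pathOf_succ, step_inv hx h.ne_one, ih (step_pos hx h)
      (irrational_step h)]

lemma irrational_gauss {x : ℝ} (h : Irrational x) : Irrational (gauss x) :=
  irrational_fract h.inv

lemma gauss_mem_Ioo {x : ℝ} (h : Irrational x) : gauss x ∈ Set.Ioo (0 : ℝ) 1 :=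
  ⟨(gauss_mem_Ico x).1.lt_of_ne (irrational_gauss h).ne_zero.symm, (gauss_mem_Ico x).2⟩

lemma pathOf_add (x : ℝ) (m n : ℕ) : pathOf x (m + n) = pathOf (step^[m] x) n := by
  rw [pathOf, pathOf, add_comm, Function.iterate_add_apply]

lemma iterate_step_inv {u : ℝ} {n : ℕ} (h : (n : ℝ) < u) : step^[n] u⁻¹ = (u - n)⁻¹ := by
  induction n with
  | zero => simp
  | succ n ih =>
    push_cast at h
    have h1 : 1 < u - n := by linarith
    rw [Function.iterate_succ_apply', ih (by linarith), step_inv (by linarith) h1.ne', step,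
      if_neg (not_lt.2 h1.le)]
    push_cast
    ring

lemma pathOf_of_lt_floor {x : ℝ} (h : Irrational x) {t : ℕ}
    (ht : t < ⌊x⁻¹⌋₊) : pathOf x t = true := by
  have h1 : ((t + 1 : ℕ) : ℝ) ≤ x⁻¹ := (Nat.le_floor_iff' (by omega)).1 ht
  have h2 := h1.lt_of_ne (h.inv.ne_nat _).symm
  push_cast at h2
  have h3 : step^[t] x = (x⁻¹ - t)⁻¹ := by
    simpa using iterate_step_inv (u := x⁻¹) (n := t) (by linarith)
  rw [pathOf, h3, firstDigit, decide_eq_true_iff]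
  exact inv_lt_one_of_one_lt₀ (by linarith)

lemma pathOf_floor_add {x : ℝ} (hx : 0 < x) (h : Irrational x) (t : ℕ) :
    pathOf x (⌊x⁻¹⌋₊ + t) = !pathOf (gauss x) t := by
  have h1 := (Nat.floor_le (inv_pos.2 hx).le).lt_of_ne (h.inv.ne_nat _).symm
  have h2 : x⁻¹ - ⌊x⁻¹⌋₊ = gauss x := by
    rw [natCast_floor_eq_intCast_floor (inv_pos.2 hx).le]
    rfl
  have h3 : step^[⌊x⁻¹⌋₊] x = (gauss x)⁻¹ := by
    simpa [h2] using iterate_step_inv h1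
  rw [pathOf_add, h3, pathOf_inv (gauss_mem_Ioo h).1 (irrational_gauss h)]

/-- The path is ⌊1 / x⌋ ones followed by the complement of the path of `gauss x`. The first block
contributes one turn, at its last digit, and complementation preserves turns. -/
lemma turnCount_digitSum (N : ℕ) {x : ℝ} (hx : x ∈ Set.Ioo (0 : ℝ) 1) (h : Irrational x) :
    turnCount (pathOf x) (digitSum N x) = N := by
  induction N generalizing x with
  | zero => simp [digitSum, turnCount]
  | succ N ih =>
    have hn : 1 ≤ ⌊x⁻¹⌋₊ := Nat.le_floor (by exact_mod_cast (one_le_inv₀ hx.1).2 hx.2.le)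
    obtain ⟨m, hm⟩ := Nat.exists_eq_add_of_le' hn
    have hend : pathOf x (m + 1) = false := by
      have := pathOf_floor_add hx.1 h 0
      rw [hm] at this
      rw [add_zero] at this
      rw [this]
      simp [pathOf, firstDigit, (gauss_mem_Ico x).2]
    have hfirst : Nat.count (fun t => pathOf x t ≠ pathOf x (t + 1)) (m + 1) = 1 := by
      rw [Nat.count_succ, if_pos (by
        rw [hend, pathOf_of_lt_floor h (show m < ⌊x⁻¹⌋₊ by omega)]; simp)]
      rw [Nat.add_eq_right, Nat.count_iff_forall_not]
      intro t ht
      rw [pathOf_of_lt_floor h (show t < ⌊x⁻¹⌋₊ by omega),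
        pathOf_of_lt_floor h (show t + 1 < ⌊x⁻¹⌋₊ by omega)]
      simp
    have hrest : (fun k => pathOf x (⌊x⁻¹⌋₊ + k) ≠ pathOf x (⌊x⁻¹⌋₊ + k + 1)) =
        fun k => pathOf (gauss x) k ≠ pathOf (gauss x) (k + 1) := by
      funext k
      rw [add_assoc, pathOf_floor_add hx.1 h, pathOf_floor_add hx.1 h]
      simp
    have hi := ih (gauss_mem_Ioo h) (irrational_gauss h)
    unfold turnCount at hi ⊢
    rw [digitSum, Nat.count_add]
    simp only [hrest, hi]
    rw [hm, hfirst, add_comm]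

lemma eventually_mul_turnCount_le {s : Path} {S : ℕ → ℕ} (hS : ∀ N, turnCount s (S N) = N)
    (hlim : ∀ C : ℕ, ∀ᶠ N in atTop, C * N < S N) (C : ℕ) :
    ∀ᶠ T in atTop, C * turnCount s T ≤ T := by
  -- With k + 1 turns before T, both 2Ck < T and 2C ≤ T hold; their average is the claim.
  obtain ⟨K, hK⟩ := eventually_atTop.1 (hlim (2 * C))
  filter_upwards [eventually_ge_atTop (2 * C * (K + 1))] with T hT
  rcases Nat.lt_or_ge K (turnCount s T) with hk | hk
  · obtain ⟨k, hk'⟩ := Nat.exists_eq_add_of_le' (Nat.one_le_of_lt hk)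
    have h1 : S k < T := by
      by_contra! hle
      have : turnCount s T ≤ turnCount s (S k) := Nat.count_monotone _ hle
      rw [hS] at this
      omega
    have h2 := hK k (by omega)
    rw [hk']
    nlinarith
  · nlinarith

lemma turnCount_xorPath_zigzag (s : Path) (T : ℕ) :
    turnCount (xorPath s zigzag) T + turnCount s T = T := by
  induction T with
  | zero => simp [turnCount]
  | succ T ih =>
    have hz : zigzag (T + 1) = !zigzag T := by
      simp only [zigzag]
      rcases Nat.mod_two_eq_zero_or_one T with h | h <;> simp [Nat.add_mod, h]
    unfold turnCount at ih ⊢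
    rw [Nat.count_succ, Nat.count_succ]
    have : (xorPath s zigzag T ≠ xorPath s zigzag (T + 1)) ↔ ¬ s T ≠ s (T + 1) := by
      simp only [xorPath, hz]
      cases s T <;> cases s (T + 1) <;> cases zigzag T <;> simp
    simp only [this]
    split_ifs <;> omega

lemma mixed_of_turns {s : Path} (h : ∀ N, ∃ n ≥ N, s n ≠ s (n + 1)) : Mixed s := by
  intro b N
  obtain ⟨n, hn, hne⟩ := h N
  by_cases hb : s n = b
  · exact ⟨n, hn, hb⟩
  · refine ⟨n + 1, by omega, ?_⟩
    revert hne hb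
    cases s n <;> cases s (n + 1) <;> cases b <;> simp

lemma mixed_of_turnCount {s : Path} (h : ∀ M, ∃ T, M < turnCount s T) : Mixed s := by
  refine mixed_of_turns fun N => ?_
  by_contra! hN
  obtain ⟨T, hT⟩ := h N
  have h1 : turnCount s T ≤ turnCount s (N + T) := Nat.count_monotone _ (by omega)
  have h2 : turnCount s (N + T) = turnCount s N := by
    rw [turnCount, Nat.count_add, turnCount, Nat.add_eq_left, Nat.count_iff_forall_not]
    intro t _
    simpa using hN (N + t) (by omega)
  have h3 : turnCount s N ≤ N := Nat.count_le _
  omega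

/-! ### Jimm on the numbers with infinite mean -/

lemma jimm_of_mem_infiniteMeanSet {x : ℝ} (hx : x ∈ infiniteMeanSet) :
    ∃ y : ℝ, jimm x = (y : OnePoint ℝ) ∧ Irrational y ∧ y ∈ Set.Ioo (0 : ℝ) 1 ∧
      Tendsto (quotientMean y) atTop (𝓝 1) := by
  have hirr := irrational_of_mem_infiniteMeanSet hx
  have hx1 : x ∈ Set.Ioo (0 : ℝ) 1 :=
    ⟨hx.1.1.lt_of_ne hirr.ne_zero.symm, hx.1.2.lt_of_ne hirr.ne_one⟩
  have hp := eventually_mul_turnCount_le (fun N => turnCount_digitSum N hx1 hirr)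
    ((tendsto_quotientMean_atTop_iff (Set.Ioo_subset_Ico_self hx1)).1 hx.2)
  set q := xorPath (pathOf x) zigzag with hq
  have hcompl : ∀ T, turnCount q T + turnCount (pathOf x) T = T :=
    turnCount_xorPath_zigzag (pathOf x)
  have hmix : Mixed q := mixed_of_turnCount fun M => by
    obtain ⟨T, hT, hT'⟩ := ((hp 2).and (eventually_gt_atTop (2 * M))).exists
    exact ⟨T, by have := hcompl T; omega⟩
  have hpath := hmix.pathOf_endpoint
  have hyirr := hmix.irrational_endpoint
  -- The zigzag starts with 0, so the image stays below 1, where `digitSum` computes its quotients.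
  have hq0 : q 0 = true := by
    simp [hq, xorPath, zigzag, pathOf, firstDigit, hx1.2]
  have hy : endpoint q ∈ Set.Ioo (0 : ℝ) 1 := by
    refine ⟨hmix.endpoint_pos, ?_⟩
    rw [← hpath] at hq0
    exact of_decide_eq_true hq0
  refine ⟨endpoint q, by rw [jimm, if_pos hx.1.1, hmix.cfm_eq], hyirr, hy, ?_⟩
  -- With S the N-th digit sum of the image, S is N plus the turns of the original path before S,
  -- and these are o(S).
  have hS : ∀ N, N + turnCount (pathOf x) (digitSum N (endpoint q)) =
      digitSum N (endpoint q) := fun N => by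
    have h1 := turnCount_digitSum N hy hyirr
    rw [hpath] at h1
    have := hcompl (digitSum N (endpoint q))
    rwa [h1] at this
  have hSt : Tendsto (fun N => digitSum N (endpoint q)) atTop atTop :=
    tendsto_atTop_mono (fun N => (Nat.le_add_right _ _).trans (hS N).le) tendsto_id
  have hlow : ∀ᶠ N in atTop, 1 ≤ quotientMean (endpoint q) N := by
    filter_upwards [eventually_gt_atTop 0] with N hN
    rw [quotientMean_eq (Set.Ioo_subset_Ico_self hy), one_le_div (by exact_mod_cast hN)]
    exact_mod_cast (Nat.le_add_right _ _).trans (hS N).le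
  refine tendsto_order.2 ⟨fun a ha => hlow.mono fun N hN => ha.trans_le hN, fun b hb => ?_⟩
  -- At most S / (C + 1) old turns give a mean of at most 1 + 1 / C, which is below b.
  obtain ⟨C, hC⟩ := exists_nat_gt (b - 1)⁻¹
  have hb0 : 0 < b - 1 := by linarith
  have hC0 : (0 : ℝ) < C := (inv_pos.2 hb0).trans hC
  filter_upwards [hSt.eventually (hp (C + 1)), eventually_gt_atTop 0] with N hN h0
  have hN0 : (0 : ℝ) < N := by exact_mod_cast h0
  rw [quotientMean_eq (Set.Ioo_subset_Ico_self hy), div_lt_iff₀ hN0]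
  have h1 : C * digitSum N (endpoint q) ≤ (C + 1) * N := by
    have := hS N
    nlinarith
  have h2 : (C : ℝ) * digitSum N (endpoint q) ≤ (C + 1) * N := by exact_mod_cast h1
  have h3 : 1 < C * (b - 1) := by
    rwa [inv_lt_iff_one_lt_mul₀ hb0] at hC
  have h4 : (C : ℝ) * digitSum N (endpoint q) < C * (b * N) := by nlinarith
  exact lt_of_mul_lt_mul_left h4 hC0.le

end Jimm

theorem mainTheorem7 {Ω : Type*} [MeasurableSpace Ω] (P : Measure Ω) (X : Ω → ℝ)
    (hX : pdf.IsUniform X (Set.Icc (0 : ℝ) 1) P volume) :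
    (∀ᵐ ω ∂P, Irrational (X ω) ∧ ∃ y : ℝ, Jimm.jimm (X ω) = (y : OnePoint ℝ) ∧ Irrational y ∧
      Tendsto (Jimm.quotientFrequency y 1) atTop (𝓝 1) ∧
      Tendsto (Jimm.quotientMean y) atTop (𝓝 1) ∧
      ¬ Jimm.ObeysGaussKuzmin y) ∧
    volume (Set.Icc (0 : ℝ) 1 \ Jimm.infiniteMeanSet) = 0 ∧
    OnePoint.infty ∉ Jimm.jimm '' Jimm.infiniteMeanSet ∧
    volume {y : ℝ | (y : OnePoint ℝ) ∈ Jimm.jimm '' Jimm.infiniteMeanSet} = 0 := by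
  have hA := Jimm.volume_Icc_diff_infiniteMeanSet
  refine ⟨?_, hA, ?_, ?_⟩
  · have hm : AEMeasurable X P := hX.aemeasurable (by simp) (by simp)
    have hae : ∀ᵐ x ∂P.map X, x ∈ Jimm.infiniteMeanSet := by
      rw [show P.map X = ProbabilityTheory.cond volume (Set.Icc (0 : ℝ) 1) from hX]
      refine (Measure.smul_absolutelyContinuous).ae_le ?_
      change ∀ᵐ x ∂volume.restrict (Set.Icc (0 : ℝ) 1), x ∈ Jimm.infiniteMeanSet
      rw [ae_restrict_iff' measurableSet_Icc, ae_iff]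
      refine measure_mono_null (fun x hx => ?_) hA
      simpa [and_assoc] using hx
    filter_upwards [ae_of_ae_map hm hae] with ω hω
    obtain ⟨y, hj, hirr, -, hmean⟩ := Jimm.jimm_of_mem_infiniteMeanSet hω
    have hfreq := Jimm.tendsto_quotientFrequency_one hirr hmean
    exact ⟨Jimm.irrational_of_mem_infiniteMeanSet hω, y, hj, hirr, hfreq, hmean,
      Jimm.not_obeysGaussKuzmin hfreq⟩
  · rintro ⟨x, hx, h⟩
    obtain ⟨y, hj, -⟩ := Jimm.jimm_of_mem_infiniteMeanSet hx
    exact OnePoint.infty_ne_coe y (h.symm.trans hj)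
  -- A point of the image has means tending to 1, so it lies in [0, 1] outside A.
  · refine measure_mono_null ?_ hA
    rintro y ⟨x, hx, h⟩
    obtain ⟨y', hj, -, hy', hmean⟩ := Jimm.jimm_of_mem_infiniteMeanSet hx
    obtain rfl : y = y' := OnePoint.coe_injective (h.symm.trans hj)
    exact ⟨Set.Ioo_subset_Icc_self hy',
      fun hmem => not_tendsto_atTop_of_tendsto_nhds hmean hmem.2⟩
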